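/- **Definitions.** A finite cubical complex is a finite family of faces, given by their vertex sets, that contains the empty face and is closed under intersection, such that the faces contained in any nonempty face form the face lattice of a cube. The face poset $P$ of a complex is the set of all its faces, including $\emptyset$, ordered by inclusion, with rank function $\rho(G)=\dim G+1$. Stanley's polynomials are defined by $f(\emptyset,x)=g(\emptyset,x)=1$ and, for a finite poset $P$ with minimum $\hat 0$, all of whose intervals $[\hat 0,t]$ are Eulerian, by $$f(P,x)=\sum_{t\in P} g([\hat 0,t),x)\,(x-1)^{d-\rho(t)},$$ where $d$ is the maximum length of a chain in $P$ and, if $\rho(t)=e+1\ge 1$ and $f([\hat 0,t),x)=\sum_i k_ix^i$ with $k_{-1}=0$, $$g([\hat 0,t),x)=\sum_{i=0}^{\lfloor e/2\rfloor}(k_i-k_{i-1})x^i .$$ The toric $h$-polynomial of a complex with face poset $P$ is $h(P,x)=x^{d}f(P,1/x)$, with $d$ as above. Let $d\ge 1$. A shelling of a $(d-1)$-dimensional cubical complex, all of whose facets have dimension $d-1$, is an ordering $F_1,\dots,F_r$ of its facets such that every $F_t$ has a type $(i,j)$, with $j=d-1$ whenever $t>1$ and $i=0$. Here $F_t$ has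 type $(i,j)$ if $F_t\cap(F_1\cup\dots\cup F_{t-1})$ is the union of some $(d-2)$-dimensional faces of the cube $F_t$, consisting of $i$ faces whose antipodal face is not among them and of $j$ antipodal pairs of faces. The first facet $F_1$ has type $(0,0)$. (For $t>1$ the condition on $(i,j)$ is the combinatorial form of the requirement that the intersection be homeomorphic to a ball or a sphere.) The change caused by adding $F_t$ to $F_1\cup\dots\cup F_{t-1}$ is the difference of the respective polynomials of the face posets of $F_1\cup\dots\cup F_t$ and of $F_1\cup\dots\cup F_{t-1}$; for $t=1$ it is the polynomial of the face poset of $F_1$. **Theorem.** Let $F_t$ be a facet of type $(i,j)$ in a shelling $F_1,\dots,F_r$ of a $(d-1)$-dimensional cubical complex, $d\ge 1$. Let $C_n=\frac1{n+1}\binom{2n}{n}$, and let $\binom{n}{m}=0$ for $m<0$. 1. If $j\ne d-1$ or $t=1$, then adding $F_t$ to $F_1\cup\dots\cup F_{t-1}$ changes $f(P,x)$ by $$f_d(i,j,x)=\sum_{k=0}^{d-1} C_{d-1-k}(1-x)^k x^{d-k}\sum_{s=0}^{j}\binom{j}{s}\binom{d+i+j-1-k-s}{k-s}$$ and changes the toric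 $h$-polynomial by $$h_d(i,j,x)=\sum_{k=0}^{d-1} C_{d-1-k}(x-1)^k \sum_{s=0}^{j}\binom{j}{s}\binom{d+i+j-1-k-s}{k-s}.$$ 2. If $t>1$, $i=0$ and $j=d-1$, then adding $F_t$ changes $f(P,x)$ by $$f_d(0,d-1,x)=\sum_{k=0}^{d-1} C_{d-1-k}\binom{d-1-k}{k}(x-1)^k$$ and changes the toric $h$-polynomial by $$h_d(0,d-1,x)=\sum_{k=0}^{d-1} C_{d-1-k}\binom{d-1-k}{k}x^{d-k}(1-x)^k .$$ -/

import Mathlib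

open Polynomial

noncomputable section

/-! ### Toric polynomials of finite (lower Eulerian) posets -/

namespace Toric

/-- The rank `ρ(t)`: the length of a longest chain descending from `t`. -/
def rank {P : Type*} [PartialOrder P] (t : P) : ℕ := (Order.height t).toNat

/-- The length of a longest chain of `P`. -/
def maxChain (P : Type*) [PartialOrder P] [Fintype P] : ℕ := Finset.univ.sup (rank : P → ℕ)

/-- `∑_{i ≤ m} (k_i - k_{i-1}) x^i` for `f = ∑ k_i x^i`, where `k_{-1} = 0`. -/
def gTrunc (m : ℕ) (f : ℤ[X]) : ℤ[X] :=
  ∑ i ∈ Finset.range (m + 1), C (f.coeff i - if i = 0 then 0 else f.coeff (i - 1)) * X ^ i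

open Classical in
/-- The polynomial `g([0̂, t), x)` of Stanley's recursion. If `t = 0̂` the half-open interval is
empty and `g = 1`. Otherwise `[0̂, t]` has rank `ρ(t) = d + 1`, and `g([0̂, t), x)` is the truncation
at degree `⌊d / 2⌋` of the differences of the coefficients of
`f([0̂, t), x) = ∑_{s < t} g([0̂, s), x) (x - 1) ^ (d - ρ(s))`.
(In a poset with a least element `0̂`, the only minimal element is `0̂`.) -/
def gBelow {P : Type*} [PartialOrder P] [Fintype P] (t : P) : ℤ[X] :=
  if IsMin t then 1
  else gTrunc ((rank t - 1) / 2)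
    (∑ s : {s : P // s < t}, gBelow s.1 * (X - 1) ^ (rank t - 1 - rank s.1))
termination_by (Finset.univ.filter (· < t)).card
decreasing_by
  refine Finset.card_lt_card (Finset.ssubset_iff_of_subset ?_ |>.2 ⟨s.1, ?_, ?_⟩)
  · intro u hu
    simp only [Finset.mem_filter, Finset.mem_univ, true_and] at hu ⊢
    exact hu.trans s.2
  · simpa using s.2
  · simp

open Classical in
/-- The polynomial `f(P, x)` of a finite lower Eulerian poset:
`f(∅, x) = 1`, and `f(P, x) = ∑_{t ∈ P} g([0̂, t), x) (x - 1) ^ (d - ρ(t))` where `d` is the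
maximum chain length of `P`. -/
def toricF (P : Type*) [PartialOrder P] [Fintype P] : ℤ[X] :=
  if IsEmpty P then 1 else ∑ t : P, gBelow t * (X - 1) ^ (maxChain P - rank t)

/-- The toric `h`-polynomial `x ^ d f(P, 1 / x)`, where `d` is the maximum chain length of `P`
(for the face poset of a complex, `d` is the dimension plus one). -/
def toricH (P : Type*) [PartialOrder P] [Fintype P] : ℤ[X] :=
  (toricF P).reflect (maxChain P)

end Toric

/-! ### Cubical complexes -/

/-- The vertex set of the nonempty face of the cube `{0,1}^n` in which coordinate `k` is free when
`c k = none`, and fixed to the value `b` when `c k = some b`. -/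
def subcube {n : ℕ} (c : Fin n → Option Bool) : Finset (Fin n → Bool) :=
  Finset.univ.filter fun v => ∀ k, c k = none ∨ c k = some (v k)

/-- In the family `S` of vertex sets, `F` is (the vertex set of) an `n`-dimensional cube:
its vertices can be labelled by `{0,1}^n` so that the members of `S` contained in `F` are exactly
the empty face and the nonempty faces of the `n`-cube. -/
def IsCube {V : Type*} [DecidableEq V] (S : Finset (Finset V)) (n : ℕ) (F : Finset V) : Prop :=
  ∃ φ : (Fin n → Bool) → V, Function.Injective φ ∧ F = Finset.univ.image φ ∧
    ∀ G ⊆ F, G ∈ S ↔ G = ∅ ∨ ∃ c : Fin n → Option Bool, G = (subcube c).image φ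

/-- A finite (abstract) cubical complex: a finite family of faces, each given by its vertex set,
containing the empty face and closed under intersection, such that each nonempty face is a cube.
(The vertex sets of the faces of every polyhedral complex of combinatorial cubes are of this
form.) -/
structure CubicalComplex (V : Type*) [DecidableEq V] where
  faces : Finset (Finset V)
  empty_mem : ∅ ∈ faces
  inter_mem : ∀ F ∈ faces, ∀ G ∈ faces, F ∩ G ∈ faces
  isCube : ∀ F ∈ faces, F.Nonempty → ∃ n, IsCube faces n F

namespace CubicalComplex

variable {V : Type*} [DecidableEq V]

open Classical in
/-- The faces of the subcomplex generated by the first `m` members of the list `F` (including the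
empty face, if `m` is positive). -/
def initialFaces (K : CubicalComplex V) {r : ℕ} (F : Fin r → Finset V) (m : ℕ) :
    Finset (Finset V) :=
  K.faces.filter fun G => ∃ s : Fin r, s.val < m ∧ G ⊆ F s

open Classical in
/-- The `(d-2)`-dimensional faces of the facet `F t` that lie in an earlier facet. -/
def sharedRidges (K : CubicalComplex V) (d : ℕ) {r : ℕ} (F : Fin r → Finset V) (t : Fin r) :
    Finset (Finset V) :=
  (K.initialFaces F t.val).filter fun G => G ⊆ F t ∧ ∃ n, n + 2 = d ∧ IsCube K.faces n G

open Classical in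
/-- The shared `(d-2)`-faces of `F t` whose antipodal face in `F t` is shared as well.
(Two `(d-2)`-faces of a `(d-1)`-cube are antipodal exactly when they are disjoint.) -/
def pairedRidges (K : CubicalComplex V) (d : ℕ) {r : ℕ} (F : Fin r → Finset V) (t : Fin r) :
    Finset (Finset V) :=
  (K.sharedRidges d F t).filter fun G => ∃ G' ∈ K.sharedRidges d F t, Disjoint G G'

/-- In the list `F` of `(d-1)`-dimensional cubes, `F t` has type `(i, j)`: the intersection of `F t`
with the union of the earlier ones is a union of `(d-2)`-faces of `F t`, namely of `i` antipodally
unpaired ones and of `j` antipodal pairs. (The first cube has type `(0, 0)`.) -/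
def HasType (K : CubicalComplex V) (d : ℕ) {r : ℕ} (F : Fin r → Finset V) (t : Fin r)
    (i j : ℕ) : Prop :=
  (∀ G ∈ K.initialFaces F t.val, G ⊆ F t → G.Nonempty → ∃ R ∈ K.sharedRidges d F t, G ⊆ R) ∧
  (K.sharedRidges d F t \ K.pairedRidges d F t).card = i ∧
  (K.pairedRidges d F t).card = 2 * j

/-- `F` is a shelling of the `(d-1)`-dimensional cubical complex `K`: a list without repetitions of
all the facets, each of dimension `d-1`, such that each facet but the first has a type `(i, j)`
where `i = 0` is possible only if `j = d-1`. -/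
structure IsShelling (K : CubicalComplex V) (d : ℕ) {r : ℕ} (F : Fin r → Finset V) : Prop where
  injective : Function.Injective F
  facets : ∀ G : Finset V, (∃ t, F t = G) ↔ Maximal (fun H => H ∈ K.faces) G
  dim : ∀ t, IsCube K.faces (d - 1) (F t)
  step : ∀ t : Fin r, t.val ≠ 0 → ∃ i j : ℕ, K.HasType d F t i j ∧ (i = 0 → j = d - 1)

/-- The face poset, ordered by inclusion, of the union of the first `m` cubes of the list `F`. -/
abbrev InitialPoset (K : CubicalComplex V) {r : ℕ} (F : Fin r → Finset V) (m : ℕ) :=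
  {G : Finset V // G ∈ K.initialFaces F m}

/-- The change of `f(P, x)` caused by adding the facet `F t` to the union of the earlier ones. The
first facet contributes the whole polynomial of its face poset. -/
def fChange (K : CubicalComplex V) {r : ℕ} (F : Fin r → Finset V) (t : Fin r) : ℤ[X] :=
  Toric.toricF (K.InitialPoset F (t.val + 1)) -
    if t.val = 0 then 0 else Toric.toricF (K.InitialPoset F t.val)

/-- The change of the toric `h`-polynomial caused by adding the facet `F t` to the union of the
earlier ones. The first facet contributes the whole toric `h`-polynomial of its face poset. -/
def hChange (K : CubicalComplex V) {r : ℕ} (F : Fin r → Finset V) (t : Fin r) : ℤ[X] :=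
  Toric.toricH (K.InitialPoset F (t.val + 1)) -
    if t.val = 0 then 0 else Toric.toricH (K.InitialPoset F t.val)

end CubicalComplex

/-- `∑_{s=0}^{j} binom(j, s) binom(d+i+j-1-k-s, k-s)`, where a binomial coefficient with a negative
lower entry is zero. -/
def shellingCoeff (d i j k : ℕ) : ℕ :=
  ∑ s ∈ Finset.range (j + 1),
    if s ≤ k then j.choose s * (d + i + j - 1 - k - s).choose (k - s) else 0

end

/-! Put `n = d - 1` and `y = x - 1`. Every nonempty initial subcomplex has rank `d`, so for `t > 1`
the change of `f` is the sum of `g(∂G) y^(d - ρ(G))` over the new faces `G`: the faces of the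
`n`-cube `F_t` lying in no shared ridge. For `t = 1` it is the sum over all faces, including the
empty one.

New faces are counted direction by direction (`exists_sum_avoiding_ridges`). A direction with both
ridges shared must stay free and contributes `1`; with one shared ridge it contributes `1 + X`, with
none `1 + 2X`. Hence the codimension generating function is `(1 + X)^i (1 + 2X)^u` with `i + j + u =
n`, to which the linear map `faceSum n : X^a ↦ g(∂C_{n-a}) y^a` is applied.

The base case is the full cube, `faceSum_cube`. In generating functions in `z`, `gCube` is the
Catalan series at `z(1 + yz)`, summing over faces is a binomial transform, and both sides solve the
same quadratic equation. The resulting polynomial has only high powers of `x`, while `gCube n` has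
degree at most `n / 2`; this gap shows inductively that Stanley's truncation gives `gCube`
(`gTrunc_eq_gCube`, `gBelow_eq`).

Types with `i > 0` follow by splitting `1 + 2X = (1 + X) + X` and `1 + X = 1 + X · 1`, mirrored by
Pascal's rule for the coefficients (`faceSum_shelling`). If `i = 0` and `j = n`, the facet itself is
the only new face, giving `gCube n`. The toric `h` statements follow by reflecting at degree `d`. -/

/-! ### Catalan power series -/

section CatalanSeries

variable {A : Type*} [CommRing A]

/-- The generating function of the Catalan numbers. -/
def catalanGF (A : Type*) [CommRing A] : PowerSeries A := PowerSeries.mk fun n => (catalan n : A)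

lemma catalanGF_eq : catalanGF A = 1 + PowerSeries.X * catalanGF A ^ 2 := by
  ext n
  cases n with
  | zero => simp [catalanGF]
  | succ n =>
    rw [map_add, PowerSeries.coeff_succ_X_mul, sq, PowerSeries.coeff_mul]
    simp [catalanGF, catalan_succ', PowerSeries.coeff_one]

/-- Since `w` has no constant term, `w ^ m` has order at least `m`. The bound `N` may exceed `n`, so
that one range serves all coefficients of a product. -/
lemma PowerSeries.coeff_subst_eq_sum_range {w : PowerSeries A}
    (hw : PowerSeries.constantCoeff w = 0) (f : PowerSeries A) {n N : ℕ} (hn : n ≤ N) :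
    PowerSeries.coeff n (f.subst w) =
      ∑ m ∈ Finset.range (N + 1), PowerSeries.coeff m f * PowerSeries.coeff n (w ^ m) := by
  rw [PowerSeries.coeff_subst' (PowerSeries.HasSubst.of_constantCoeff_zero' hw)]
  simp only [smul_eq_mul]
  apply finsum_eq_sum_of_support_subset
  intro m hm
  simp only [Function.mem_support] at hm
  simp only [Finset.coe_range, Set.mem_Iio]
  by_contra h
  refine hm (mul_eq_zero_of_right _ (PowerSeries.coeff_of_lt_order _ ?_))
  have h1 := PowerSeries.le_order_pow_of_constantCoeff_eq_zero m hw
  refine lt_of_lt_of_le ?_ h1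
  exact_mod_cast (by omega : n < m)

lemma coeff_one_add_C_mul_X_pow (a : A) (m k : ℕ) :
    PowerSeries.coeff k ((1 + PowerSeries.C a * PowerSeries.X) ^ m) = (m.choose k : A) * a ^ k := by
  have h : (1 + PowerSeries.C a * PowerSeries.X : PowerSeries A) ^ m =
      (((1 + Polynomial.C a * Polynomial.X) ^ m : A[X]) : PowerSeries A) := by simp
  rw [h, Polynomial.coeff_coe]
  have h2 : ((1 + Polynomial.C a * Polynomial.X) ^ m : A[X]) =
      ((1 + Polynomial.X) ^ m : A[X]).comp (Polynomial.C a * Polynomial.X) := by simp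
  rw [h2, Polynomial.comp_C_mul_X_coeff, Polynomial.coeff_one_add_X_pow]

/-- With `b = 1`, `a = y` these are the polynomials `gCube n`; with `b = 1 + y = x`, `a = -y` they
are the closed form for the whole cube, up to a factor `x`. -/
lemma coeff_catalanGF_subst (b a : A) (n : ℕ) :
    PowerSeries.coeff n ((catalanGF A).subst
      (PowerSeries.C b * PowerSeries.X * (1 + PowerSeries.C a * PowerSeries.X))) =
    ∑ k ∈ Finset.range (n + 1),
      (catalan (n - k) : A) * ((n - k).choose k : A) * b ^ (n - k) * a ^ k := by
  rw [PowerSeries.coeff_subst_eq_sum_range (by simp) _ le_rfl, ← Finset.sum_range_reflect]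
  refine Finset.sum_congr rfl fun k hk => ?_
  have hk' : k ≤ n := by simpa [Nat.lt_succ_iff] using hk
  rw [show n + 1 - 1 - k = n - k by omega, mul_pow, mul_pow, ← map_pow, mul_assoc,
    PowerSeries.coeff_C_mul, PowerSeries.coeff_X_pow_mul', if_pos (by omega),
    show n - (n - k) = k by omega, coeff_one_add_C_mul_X_pow]
  simp only [catalanGF, PowerSeries.coeff_mk]
  ring

/-- The geometric series `1 / (1 - c X)`. -/
def geomSeries (c : A) : PowerSeries A := PowerSeries.mk fun n => c ^ n

lemma geomSeries_mul (c : A) :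
    geomSeries c * (1 - PowerSeries.C c * PowerSeries.X) = 1 := by
  ext n
  rw [mul_sub, mul_one, ← mul_assoc, map_sub]
  cases n with
  | zero => simp [geomSeries]
  | succ n =>
    rw [PowerSeries.coeff_succ_mul_X, mul_comm, PowerSeries.coeff_C_mul]
    simp [geomSeries, PowerSeries.coeff_one, pow_succ']

lemma coeff_geomSeries_pow (c : A) (d n : ℕ) :
    PowerSeries.coeff n (geomSeries c ^ (d + 1)) = ((d + n).choose d : A) * c ^ n := by
  have h : geomSeries c = PowerSeries.rescale c (PowerSeries.mk 1) := by
    ext; simp [geomSeries]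
  rw [h, ← map_pow, PowerSeries.mk_one_pow_eq_mk_choose_add, PowerSeries.coeff_rescale,
    PowerSeries.coeff_mk, mul_comm]

/-- The binomial transform of a power series is a substitution. -/
lemma coeff_subst_geomSeries_mul (c : A) (f : PowerSeries A) (N : ℕ) :
    PowerSeries.coeff N (f.subst (PowerSeries.X * geomSeries c) * geomSeries c) =
      ∑ a ∈ Finset.range (N + 1), (N.choose a : A) * c ^ a * PowerSeries.coeff (N - a) f := by
  have key : PowerSeries.coeff N (f.subst (PowerSeries.X * geomSeries c) * geomSeries c) =
      ∑ m ∈ Finset.range (N + 1), PowerSeries.coeff m f *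
        PowerSeries.coeff N ((PowerSeries.X * geomSeries c) ^ m * geomSeries c) := by
    simp_rw [PowerSeries.coeff_mul, Finset.mul_sum]
    rw [Finset.sum_comm]
    refine Finset.sum_congr rfl fun p hp => ?_
    rw [PowerSeries.coeff_subst_eq_sum_range (w := PowerSeries.X * geomSeries c) (by simp) f
      (by have := Finset.HasAntidiagonal.mem_antidiagonal.1 hp; omega : p.1 ≤ N), Finset.sum_mul]
    exact Finset.sum_congr rfl fun _ _ => by ring
  rw [key, ← Finset.sum_range_reflect]
  refine Finset.sum_congr rfl fun a ha => ?_
  have ha' : a ≤ N := by simpa [Nat.lt_succ_iff] using ha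
  rw [show N + 1 - 1 - a = N - a by omega, mul_pow, mul_assoc, ← pow_succ,
    PowerSeries.coeff_X_pow_mul', if_pos (by omega), coeff_geomSeries_pow,
    show N - (N - a) = a by omega, show N - a + a = N by omega, Nat.choose_symm ha']
  ring

lemma catalanGF_subst_eq {w : PowerSeries A} (hw : PowerSeries.constantCoeff w = 0) :
    (catalanGF A).subst w = 1 + w * ((catalanGF A).subst w) ^ 2 := by
  have hs : PowerSeries.HasSubst w := PowerSeries.HasSubst.of_constantCoeff_zero' hw
  conv_lhs => rw [catalanGF_eq]
  rw [← PowerSeries.coe_substAlgHom hs, map_add, map_mul, map_pow, map_one,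
    PowerSeries.substAlgHom_X hs]

/-- Uniqueness of the power series solution of a quadratic equation. -/
lemma quadratic_unique {D s H H' : PowerSeries A} (hD : PowerSeries.constantCoeff D = 1)
    (hs : PowerSeries.constantCoeff s = 0) (h : D * H = 1 + s * H ^ 2)
    (h' : D * H' = 1 + s * H' ^ 2) : H = H' := by
  -- Subtracting the equations leaves `H - H'` times this factor, whose constant term is `1`.
  have hu : IsUnit (D - s * (H + H')) := by
    rw [PowerSeries.isUnit_iff_constantCoeff]; simp [hD, hs]
  have : (D - s * (H + H')) * (H - H') = 0 := by linear_combination h - h'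
  exact sub_eq_zero.1 ((hu.mul_right_eq_zero).1 this)

/-- Both `S * E` and `(1 + y) K - y Q` solve `(1 - 2yz) H = 1 + z (1 - yz) H²`, which has only one
power series solution. The term `y Q` accounts for the empty face. -/
theorem catalan_binomial_transform_series (y : A) :
    PowerSeries.subst (PowerSeries.X * geomSeries (2 * y) : PowerSeries A)
        ((catalanGF A).subst (PowerSeries.C 1 * PowerSeries.X *
          (1 + PowerSeries.C y * PowerSeries.X) : PowerSeries A) : PowerSeries A) *
        geomSeries (2 * y) + PowerSeries.C y * geomSeries y =
      PowerSeries.C (1 + y) * (catalanGF A).subst (PowerSeries.C (1 + y) * PowerSeries.X *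
        (1 + PowerSeries.C (-y) * PowerSeries.X) : PowerSeries A) := by
  set G : PowerSeries A := (catalanGF A).subst (PowerSeries.C 1 * PowerSeries.X *
    (1 + PowerSeries.C y * PowerSeries.X) : PowerSeries A) with hG
  set E := geomSeries (2 * y) with hE
  set K : PowerSeries A := (catalanGF A).subst (PowerSeries.C (1 + y) * PowerSeries.X *
    (1 + PowerSeries.C (-y) * PowerSeries.X) : PowerSeries A) with hK
  set Q := geomSeries y with hQ
  have hEe : E * (1 - PowerSeries.C (2 * y) * PowerSeries.X) = 1 := geomSeries_mul _
  have hQe : Q * (1 - PowerSeries.C y * PowerSeries.X) = 1 := geomSeries_mul _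
  have hGe : G = 1 + PowerSeries.C (1 : A) * PowerSeries.X *
      (1 + PowerSeries.C y * PowerSeries.X) * G ^ 2 := catalanGF_subst_eq (by simp)
  have hKe : K = 1 + PowerSeries.C (1 + y) * PowerSeries.X *
      (1 + PowerSeries.C (-y) * PowerSeries.X) * K ^ 2 := catalanGF_subst_eq (by simp)
  have hw : PowerSeries.HasSubst (PowerSeries.X * E : PowerSeries A) :=
    PowerSeries.HasSubst.of_constantCoeff_zero' (by simp)
  set S : PowerSeries A := G.subst (PowerSeries.X * E) with hS
  have hSe : S = 1 + PowerSeries.X * E * (1 + PowerSeries.C y * (PowerSeries.X * E)) * S ^ 2 := by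
    have h2 : G.subst (PowerSeries.X * E) =
        (1 + PowerSeries.X * (1 + y • PowerSeries.X) * G ^ 2).subst (PowerSeries.X * E) := by
      conv_lhs => rw [hGe]
      simp [PowerSeries.smul_eq_C_mul]
    refine (hS.trans h2).trans ?_
    simp only [← PowerSeries.coe_substAlgHom hw]
    simp only [map_add, map_mul, map_pow, map_one, PowerSeries.substAlgHom_X hw, map_smul]
    simp only [PowerSeries.coe_substAlgHom hw, PowerSeries.smul_eq_C_mul]
    rw [hS]
  have h := quadratic_unique (D := 1 - PowerSeries.C (2 * y) * PowerSeries.X)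
    (s := PowerSeries.X * (1 - PowerSeries.C y * PowerSeries.X))
    (H := S * E) (H' := PowerSeries.C (1 + y) * K - PowerSeries.C y * Q) (by simp) (by simp) ?_ ?_
  · rw [h]; ring
  · simp only [map_mul, map_ofNat] at hEe ⊢
    have : (1 - 2 * PowerSeries.C y * PowerSeries.X) * (S * E) = S := by linear_combination S * hEe
    rw [this]
    linear_combination hSe - PowerSeries.X * S ^ 2 * E * hEe
  · simp only [map_mul, map_ofNat, map_add, map_one, map_neg] at hKe ⊢
    linear_combination (1 + PowerSeries.C y) * hKe +
      (2 * (1 + PowerSeries.C y) * PowerSeries.C y * PowerSeries.X * K - PowerSeries.C y -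
        PowerSeries.C y ^ 2 * PowerSeries.X * Q) * hQe
end CatalanSeries

/-! ### The polynomials of the cube and of its shelling steps -/

/-- The polynomial `g` of the boundary of the `n`-cube. -/
noncomputable def gCube (n : ℕ) : ℤ[X] :=
  ∑ k ∈ Finset.range (n + 1), (catalan (n - k) : ℤ[X]) * ((n - k).choose k : ℤ[X]) * (X - 1) ^ k

/-- The closed form of the change of `f` caused by an `n`-cube of type `(i, j)`. -/
noncomputable def shellingPoly (n i j : ℕ) : ℤ[X] :=
  ∑ k ∈ Finset.range (n + 1), (catalan (n - k) : ℤ[X]) * (1 - X) ^ k * X ^ (n + 1 - k) *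
    (shellingCoeff (n + 1) i j k : ℤ[X])

/-- The weighted sum `∑ p_a g(C_{n-a}) (X - 1) ^ a` over the numbers `p_a` of faces of
codimension `a` in the `n`-cube. -/
noncomputable def faceSum (n : ℕ) (p : ℤ[X]) : ℤ[X] :=
  ∑ a ∈ Finset.range (n + 1), C (p.coeff a) * gCube (n - a) * (X - 1) ^ a

lemma faceSum_add (n : ℕ) (p q : ℤ[X]) : faceSum n (p + q) = faceSum n p + faceSum n q := by
  simp [faceSum, add_mul, Finset.sum_add_distrib]

lemma faceSum_sum {ι : Type*} (n : ℕ) (s : Finset ι) (p : ι → ℤ[X]) :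
    faceSum n (∑ c ∈ s, p c) = ∑ c ∈ s, faceSum n (p c) := by
  classical
  induction s using Finset.induction_on with
  | empty => simp [faceSum]
  | insert a s ha ih => rw [Finset.sum_insert ha, Finset.sum_insert ha, faceSum_add, ih]

lemma faceSum_X_pow {n a : ℕ} (ha : a ≤ n) :
    faceSum n (X ^ a) = gCube (n - a) * (X - 1) ^ a := by
  rw [faceSum, Finset.sum_eq_single a]
  · simp
  · intro b _ hb; simp [Polynomial.coeff_X_pow, hb]
  · intro h; simp at h; omega

lemma faceSum_one (n : ℕ) : faceSum n 1 = gCube n := by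
  simpa using faceSum_X_pow (n := n) (a := 0) (Nat.zero_le _)

/-- Fixing one coordinate passes to a cube of one dimension less and raises the codimension by one.
-/
lemma faceSum_succ_X_mul (n : ℕ) (p : ℤ[X]) :
    faceSum (n + 1) (X * p) = (X - 1) * faceSum n p := by
  rw [faceSum, Finset.sum_range_succ', faceSum, Finset.mul_sum]
  simp only [coeff_X_mul, coeff_X_mul_zero, map_zero, zero_mul, add_zero, Nat.add_sub_add_right]
  exact Finset.sum_congr rfl fun _ _ => by ring

lemma coeff_one_add_two_mul_X_pow (n a : ℕ) :
    ((1 + 2 * X : ℤ[X]) ^ n).coeff a = (n.choose a : ℤ) * 2 ^ a := by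
  have h2 : ((1 + 2 * X) ^ n : ℤ[X]) = ((1 + X) ^ n : ℤ[X]).comp (C 2 * X) := by simp
  rw [h2, Polynomial.comp_C_mul_X_coeff, Polynomial.coeff_one_add_X_pow]

lemma shellingCoeff_zero_zero (n k : ℕ) : shellingCoeff (n + 1) 0 0 k = (n - k).choose k := by
  simp [shellingCoeff]

/-- This is the coefficient of `z^n` in `catalan_binomial_transform_series` at `y = X - 1`; the
first summand is the weight of the empty face. -/
theorem faceSum_cube (n : ℕ) :
    (X - 1) ^ (n + 1) + faceSum n ((1 + 2 * X) ^ n) = shellingPoly n 0 0 := by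
  have h := congrArg (PowerSeries.coeff n) (catalan_binomial_transform_series (X - 1 : ℤ[X]))
  rw [map_add, coeff_subst_geomSeries_mul, PowerSeries.coeff_C_mul, PowerSeries.coeff_C_mul,
    coeff_catalanGF_subst] at h
  simp only [coeff_catalanGF_subst, geomSeries, PowerSeries.coeff_mk] at h
  rw [← pow_succ', add_comm] at h
  have h1 : faceSum n ((1 + 2 * X) ^ n) = ∑ a ∈ Finset.range (n + 1), (n.choose a : ℤ[X]) *
      (2 * (X - 1)) ^ a * ∑ k ∈ Finset.range (n - a + 1), (catalan (n - a - k) : ℤ[X]) *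
        ((n - a - k).choose k : ℤ[X]) * 1 ^ (n - a - k) * (X - 1) ^ k := by
    refine Finset.sum_congr rfl fun a _ => ?_
    rw [coeff_one_add_two_mul_X_pow, gCube]
    simp only [one_pow, mul_one, map_mul, map_pow, map_natCast, mul_pow]
    simp only [map_ofNat]
    ring
  rw [h1, h, shellingPoly, Finset.mul_sum]
  refine Finset.sum_congr rfl fun k hk => ?_
  have hk' : k ≤ n := by simpa [Nat.lt_succ_iff] using hk
  rw [shellingCoeff_zero_zero, show n + 1 - k = (n - k) + 1 by omega]
  ring

/-- Pascal's rule for the second binomial, summand by summand. The bound on `k` keeps the natural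
subtractions from truncating. -/
lemma shellingCoeff_succ_left {n i j k : ℕ} (hk : k ≤ n + 1) :
    shellingCoeff (n + 2) (i + 1) j k =
      shellingCoeff (n + 2) i j k + if k = 0 then 0 else shellingCoeff (n + 1) i j (k - 1) := by
  rcases k with _ | k
  · simp only [shellingCoeff, if_true, add_zero]
    refine Finset.sum_congr rfl fun s _ => ?_
    split_ifs with h
    · simp [Nat.le_zero.1 h]
    · rfl
  · simp only [shellingCoeff, Nat.add_sub_cancel, Nat.succ_ne_zero, if_false,
      ← Finset.sum_add_distrib]
    refine Finset.sum_congr rfl fun s hs => ?_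
    have hs' : s ≤ j := by simpa [Nat.lt_succ_iff] using hs
    rcases lt_trichotomy s (k + 1) with h | rfl | h
    · rw [if_pos (by omega), if_pos (by omega), if_pos (by omega), ← mul_add,
        show n + 2 + (i + 1) + j - 1 - (k + 1) - s = (n + 1 + i + j - 1 - k - s) + 1 by omega,
        show n + 2 + i + j - 1 - (k + 1) - s = n + 1 + i + j - 1 - k - s by omega,
        show k + 1 - s = k - s + 1 by omega, Nat.choose_succ_succ', add_comm (Nat.choose _ _)]
    · simp
    · rw [if_neg (by omega), if_neg (by omega), if_neg (by omega)]

/-- Pascal's rule for `(j + 1).choose (s + 1)`: the part with `j.choose (s + 1)` belongs to type `(i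
+ 1, j)`, and the part with `j.choose s` becomes the lower-dimensional coefficient at `k - 1`. -/
lemma shellingCoeff_succ_right {n i j k : ℕ} :
    shellingCoeff (n + 2) i (j + 1) k = shellingCoeff (n + 2) (i + 1) j k +
      if k = 0 then 0 else shellingCoeff (n + 1) i j (k - 1) := by
  simp only [shellingCoeff]
  rw [Finset.sum_range_succ']
  have h1 : ∀ s, (if s + 1 ≤ k then (j + 1).choose (s + 1) *
      (n + 2 + i + (j + 1) - 1 - k - (s + 1)).choose (k - (s + 1)) else 0) =
      (if s + 1 ≤ k then j.choose (s + 1) *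
        (n + 2 + (i + 1) + j - 1 - k - (s + 1)).choose (k - (s + 1)) else 0) +
      (if k = 0 then 0 else if s ≤ k - 1 then j.choose s *
        (n + 1 + i + j - 1 - (k - 1) - s).choose (k - 1 - s) else 0) := by
    intro s
    by_cases h : s + 1 ≤ k
    · rw [if_pos h, if_pos h, if_neg (by omega), if_pos (by omega), Nat.choose_succ_succ', add_mul,
        add_comm,
        show n + 2 + i + (j + 1) - 1 - k - (s + 1) = n + 1 + i + j - 1 - (k - 1) - s by omega,
        show n + 2 + (i + 1) + j - 1 - k - (s + 1) = n + 1 + i + j - 1 - (k - 1) - s by omega,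
        show k - (s + 1) = k - 1 - s by omega]
    · rw [if_neg h, if_neg h]
      by_cases h0 : k = 0
      · simp [h0]
      · rw [if_neg h0, if_neg (by omega)]
  simp_rw [h1, Finset.sum_add_distrib]
  rw [Finset.sum_range_succ (fun s => if s + 1 ≤ k then j.choose (s + 1) *
        (n + 2 + (i + 1) + j - 1 - k - (s + 1)).choose (k - (s + 1)) else 0),
    Finset.sum_range_succ' (fun s => if s ≤ k then j.choose s *
        (n + 2 + (i + 1) + j - 1 - k - s).choose (k - s) else 0)]
  have h2 : n + 2 + i + (j + 1) - 1 - k - 0 = n + 2 + (i + 1) + j - 1 - k - 0 := by omega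
  rw [h2]
  by_cases h0 : k = 0
  · simp [h0]
  · simp only [h0, if_false, Finset.sum_range_succ, Nat.choose_succ_self, Nat.choose_zero_right]
    simp
    ring

/-- A Pascal-type recursion of the coefficients gives a recursion of the polynomials. -/
lemma shellingPoly_eq_add {n i j i' j' i'' j'' : ℕ}
    (h : ∀ k ≤ n + 1, shellingCoeff (n + 2) i j k = shellingCoeff (n + 2) i' j' k +
      if k = 0 then 0 else shellingCoeff (n + 1) i'' j'' (k - 1)) :
    shellingPoly (n + 1) i' j' = shellingPoly (n + 1) i j + (X - 1) * shellingPoly n i'' j'' := by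
  have h1 : shellingPoly (n + 1) i j = shellingPoly (n + 1) i' j' +
      ∑ k ∈ Finset.range (n + 1 + 1), (catalan (n + 1 - k) : ℤ[X]) * (1 - X) ^ k *
        X ^ (n + 1 + 1 - k) *
        ((if k = 0 then 0 else shellingCoeff (n + 1) i'' j'' (k - 1) : ℕ) : ℤ[X]) := by
    rw [shellingPoly, shellingPoly, ← Finset.sum_add_distrib]
    refine Finset.sum_congr rfl fun k hk => ?_
    rw [h k (by simpa [Nat.lt_succ_iff] using hk), Nat.cast_add, mul_add]
  rw [h1, Finset.sum_range_succ', shellingPoly.eq_1 n, Finset.mul_sum, add_assoc,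
    add_right_comm _ _ (Finset.sum _ _)]
  rw [eq_comm, add_assoc, add_eq_left]
  simp only [if_true, Nat.cast_zero, mul_zero, add_zero, ← Finset.sum_add_distrib]
  refine Finset.sum_eq_zero fun k _ => ?_
  simp only [Nat.add_sub_add_right, Nat.succ_ne_zero, if_false, Nat.add_sub_cancel]
  ring

/-- Each induction step trades one direction: `1 + 2X` for `1 + X` when `i` grows, `1 + X` for `1`
when `j` grows. The difference is `X` times the polynomial of a cube of one dimension less. -/
theorem faceSum_shelling (i j u : ℕ) :
    faceSum (i + 1 + j + u) ((1 + X) ^ (i + 1) * (1 + 2 * X) ^ u) =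
      shellingPoly (i + 1 + j + u) (i + 1) j := by
  induction j generalizing i u with
  | zero =>
    induction i generalizing u with
    | zero =>
      -- The empty-face terms of `h1` and of `X - 1` times `h2` cancel, so none remains once `i` is
      -- positive.
      have h1 := faceSum_cube (u + 1)
      have h2 := faceSum_cube u
      have h3 := shellingPoly_eq_add (n := u) (i := 1) (j := 0) (i' := 0) (j' := 0) (i'' := 0)
        (j'' := 0) fun k hk => shellingCoeff_succ_left hk
      have h4 : (1 + 2 * X : ℤ[X]) ^ (u + 1) =
        (1 + X) ^ (0 + 1) * (1 + 2 * X) ^ u + X * (1 + 2 * X) ^ u := by ring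
      rw [h4, faceSum_add, faceSum_succ_X_mul] at h1
      rw [show 0 + 1 + 0 + u = u + 1 by ring]
      linear_combination h1 - (X - 1) * h2 + h3
    | succ i ih =>
      have h1 := ih (u + 1)
      have h2 := ih u
      have h3 := shellingPoly_eq_add (n := i + 1 + 0 + u) (i := i + 1 + 1) (j := 0) (i' := i + 1)
        (j' := 0) (i'' := i + 1) (j'' := 0) fun k hk => shellingCoeff_succ_left hk
      have h4 : (1 + X) ^ (i + 1) * (1 + 2 * X : ℤ[X]) ^ (u + 1) =
        (1 + X) ^ (i + 1 + 1) * (1 + 2 * X) ^ u +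
          X * ((1 + X) ^ (i + 1) * (1 + 2 * X) ^ u) := by ring
      rw [h4, faceSum_add, show i + 1 + 0 + (u + 1) = i + 1 + 0 + u + 1 by ring,
        faceSum_succ_X_mul] at h1
      rw [show i + 1 + 1 + 0 + u = i + 1 + 0 + u + 1 by ring]
      linear_combination h1 - (X - 1) * h2 + h3
  | succ j ih =>
    have h1 := ih (i + 1) u
    have h2 := ih i u
    have h3 := shellingPoly_eq_add (n := i + 1 + j + u) (i := i + 1) (j := j + 1)
      (i' := i + 1 + 1) (j' := j) (i'' := i + 1) (j'' := j) fun k _ => shellingCoeff_succ_right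
    have h4 : (1 + X) ^ (i + 1 + 1) * (1 + 2 * X : ℤ[X]) ^ u =
      (1 + X) ^ (i + 1) * (1 + 2 * X) ^ u + X * ((1 + X) ^ (i + 1) * (1 + 2 * X) ^ u) := by ring
    rw [h4, faceSum_add, show i + 1 + 1 + j + u = i + 1 + j + u + 1 by ring,
      faceSum_succ_X_mul] at h1
    rw [show i + 1 + (j + 1) + u = i + 1 + j + u + 1 by ring]
    linear_combination h1 - (X - 1) * h2 + h3

/-! ### Truncation -/

lemma Toric.coeff_gTrunc (m : ℕ) (f : ℤ[X]) (i : ℕ) :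
    (Toric.gTrunc m f).coeff i = if i ≤ m then ((1 - X) * f).coeff i else 0 := by
  have h : ∀ i, ((1 - X) * f).coeff i = f.coeff i - if i = 0 then 0 else f.coeff (i - 1) := by
    rintro (_ | i) <;> simp [sub_mul]
  rw [h, Toric.gTrunc, Polynomial.finsetSum_coeff]
  simp only [Polynomial.coeff_C_mul_X_pow]
  rw [Finset.sum_ite_eq]
  simp

/-- The binomial `(n - k).choose k` vanishes for `2k > n`, which bounds the degree by `n / 2`. -/
lemma coeff_gCube {n i : ℕ} (h : n / 2 < i) : (gCube n).coeff i = 0 := by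
  rw [gCube, Polynomial.finsetSum_coeff]
  refine Finset.sum_eq_zero fun k hk => ?_
  by_cases hk2 : n - k < k
  · simp [Nat.choose_eq_zero_of_lt hk2]
  · rw [mul_assoc, ← C_eq_natCast, ← C_eq_natCast, coeff_C_mul, coeff_C_mul,
      coeff_eq_zero_of_natDegree_lt, mul_zero, mul_zero]
    refine lt_of_le_of_lt (natDegree_pow_le_of_le k (m := 1) ?_) (by omega)
    exact (natDegree_X_sub_C (1 : ℤ)).le

lemma coeff_shellingPoly_zero {n i : ℕ} (h : i ≤ n / 2) : (shellingPoly n 0 0).coeff i = 0 := by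
  rw [shellingPoly, Polynomial.finsetSum_coeff]
  refine Finset.sum_eq_zero fun k hk => ?_
  rw [shellingCoeff_zero_zero]
  by_cases hk2 : n - k < k
  · simp [Nat.choose_eq_zero_of_lt hk2]
  · rw [mul_right_comm, coeff_mul_X_pow', if_neg (by omega)]

/-- The truncation keeps the part of `(1 - X) * f = gCube n - shellingPoly n 0 0` up to degree `n /
2`: all of `gCube n` and nothing of the other term. -/
lemma gTrunc_eq_gCube {n : ℕ} {f : ℤ[X]} (h : (X - 1) * f + gCube n = shellingPoly n 0 0) :
    Toric.gTrunc (n / 2) f = gCube n := by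
  ext i
  rw [Toric.coeff_gTrunc]
  split_ifs with hi
  · rw [show (1 - X) * f = gCube n - shellingPoly n 0 0 by linear_combination -h, coeff_sub,
      coeff_shellingPoly_zero hi, sub_zero]
  · rw [coeff_gCube (by omega)]

/-! ### Reflection -/

lemma natDegree_one_sub_X_pow_le (k : ℕ) : ((1 - X : ℤ[X]) ^ k).natDegree ≤ k := by
  simpa using natDegree_pow_le_of_le k (m := 1) (p := (1 - X : ℤ[X])) (by compute_degree)

lemma natDegree_X_sub_one_pow_le (k : ℕ) : ((X - 1 : ℤ[X]) ^ k).natDegree ≤ k := by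
  simpa using natDegree_pow_le_of_le k (m := 1) (p := (X - 1 : ℤ[X])) (by compute_degree)

lemma reflect_one_sub_X_pow (k : ℕ) : ((1 - X : ℤ[X]) ^ k).reflect k = (X - 1) ^ k := by
  induction k with
  | zero => simp
  | succ k ih =>
    rw [pow_succ, reflect_mul _ _ (natDegree_one_sub_X_pow_le k) (G := 1) (by compute_degree), ih,
      pow_succ, reflect_sub, reflect_one_X, reflect_one, pow_one]

lemma reflect_X_sub_one_pow (k : ℕ) : ((X - 1 : ℤ[X]) ^ k).reflect k = (1 - X) ^ k := by
  rw [← reflect_one_sub_X_pow, reflect_reflect]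

lemma reflect_sum {ι : Type*} (s : Finset ι) (p : ι → ℤ[X]) (N : ℕ) :
    (∑ c ∈ s, p c).reflect N = ∑ c ∈ s, (p c).reflect N := by
  classical
  induction s using Finset.induction_on with
  | empty => simp
  | insert a s ha ih => rw [Finset.sum_insert ha, Finset.sum_insert ha, reflect_add, ih]

lemma reflect_shellingPoly (n i j : ℕ) :
    (shellingPoly n i j).reflect (n + 1) = ∑ k ∈ Finset.range (n + 1),
      (catalan (n - k) : ℤ[X]) * (X - 1) ^ k * (shellingCoeff (n + 1) i j k : ℤ[X]) := by
  rw [shellingPoly, reflect_sum]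
  refine Finset.sum_congr rfl fun k hk => ?_
  have hk' : k ≤ n := by simpa [Nat.lt_succ_iff] using hk
  rw [mul_comm _ (shellingCoeff _ _ _ _ : ℤ[X]), mul_assoc, ← C_eq_natCast, ← C_eq_natCast,
    reflect_C_mul, reflect_C_mul]
  have h : ((1 - X : ℤ[X]) ^ k * X ^ (n + 1 - k)).reflect (k + (n + 1 - k)) = (X - 1) ^ k := by
    rw [reflect_mul _ _ (natDegree_one_sub_X_pow_le k) (natDegree_X_pow_le _),
      reflect_one_sub_X_pow, reflect_monomial, revAt_le le_rfl]
    simp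
  rw [show k + (n + 1 - k) = n + 1 by omega] at h
  rw [h]; ring

lemma reflect_gCube (n : ℕ) :
    (gCube n).reflect (n + 1) = ∑ k ∈ Finset.range (n + 1),
      (catalan (n - k) : ℤ[X]) * ((n - k).choose k : ℤ[X]) * X ^ (n + 1 - k) * (1 - X) ^ k := by
  rw [gCube, reflect_sum]
  refine Finset.sum_congr rfl fun k hk => ?_
  have hk' : k ≤ n := by simpa [Nat.lt_succ_iff] using hk
  rw [mul_assoc, ← C_eq_natCast, ← C_eq_natCast, reflect_C_mul, reflect_C_mul]
  have h : ((X - 1 : ℤ[X]) ^ k * 1).reflect (k + (n + 1 - k)) =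
      (1 - X) ^ k * X ^ (n + 1 - k) := by
    rw [reflect_mul _ _ (natDegree_X_sub_one_pow_le k) (by simp), reflect_X_sub_one_pow,
      reflect_one]
  rw [show k + (n + 1 - k) = n + 1 by omega, mul_one] at h
  rw [h]; ring

/-! ### Faces of the cube -/

section Subcube

variable {n : ℕ}

lemma mem_subcube {c : Fin n → Option Bool} {v : Fin n → Bool} :
    v ∈ subcube c ↔ ∀ k, c k = none ∨ c k = some (v k) := by
  simp [subcube]

lemma subcube_subset_subcube {c c' : Fin n → Option Bool} :
    subcube c ⊆ subcube c' ↔ ∀ k, c' k = none ∨ c' k = c k := by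
  constructor
  · intro h k
    by_contra hk
    push Not at hk
    obtain ⟨b, hb⟩ := Option.ne_none_iff_exists'.1 hk.1
    -- A vertex of the face `c` whose coordinate `k` is opposite to the value `b` prescribed by
    -- `c'`.
    have hv : (fun l => if l = k then !b else (c l).getD true) ∈ subcube c ∨ c k = some b := by
      rcases hc : c k with _ | b'
      · left
        rw [mem_subcube]
        intro l
        by_cases hl : l = k
        · subst hl; exact Or.inl hc
        · rcases hcl : c l with _ | b''
          · exact Or.inl rfl
          · simp [hl]
      · left
        have hne : b' = !b := by
          have : b ≠ b' := fun e => hk.2 (by rw [hb, hc, e])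
          revert this; cases b <;> cases b' <;> simp
        rw [mem_subcube]
        intro l
        by_cases hl : l = k
        · subst hl; right; simp [hc, hne]
        · rcases hcl : c l with _ | b''
          · exact Or.inl rfl
          · simp [hl]
    rcases hv with hv | hv
    · have := (mem_subcube.1 (h hv)) k
      simp [hb] at this
    · exact hk.2 (by rw [hb, hv])
  · intro h v hv
    rw [mem_subcube] at hv ⊢
    intro k
    rcases h k with h1 | h1
    · exact Or.inl h1
    · rw [h1]; exact hv k

lemma subcube_injective : Function.Injective (subcube : (Fin n → Option Bool) → _) := by
  intro c c' h
  have h1 := subcube_subset_subcube.1 h.subset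
  have h2 := subcube_subset_subcube.1 h.symm.subset
  funext k
  rcases h1 k with h3 | h3
  · rcases h2 k with h4 | h4
    · rw [h3, h4]
    · exact h4
  · exact h3.symm

/-- The codimension of the face `c`: the number of its fixed coordinates. -/
def numFixed (c : Fin n → Option Bool) : ℕ := (Finset.univ.filter fun k => c k ≠ none).card

lemma numFixed_le (c : Fin n → Option Bool) : numFixed c ≤ n :=
  (Finset.card_le_univ _).trans_eq (Fintype.card_fin n)

lemma card_subcube (c : Fin n → Option Bool) : (subcube c).card = 2 ^ (n - numFixed c) := by
  have h : subcube c = Fintype.piFinset fun k => Finset.univ.filter fun b =>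
      c k = none ∨ c k = some b := by
    ext v; simp [mem_subcube, Fintype.mem_piFinset]
  have h1 : ∀ k, (Finset.univ.filter fun b => c k = none ∨ c k = some b).card =
      if c k = none then 2 else 1 := by
    intro k
    rcases c k with _ | b
    · simp
    · simp [Finset.filter_eq]
  rw [h, Fintype.card_piFinset]
  simp_rw [h1]
  rw [Finset.prod_ite, Finset.prod_const, Finset.prod_const_one, mul_one]
  congr 1
  have := Finset.card_filter_add_card_filter_not (s := (Finset.univ : Finset (Fin n)))
    (fun k => c k = none)
  simp only [Finset.card_univ, Fintype.card_fin] at this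
  rw [numFixed]
  simp only [ne_eq]
  omega

lemma subcube_nonempty (c : Fin n → Option Bool) : (subcube c).Nonempty := by
  rw [← Finset.card_pos, card_subcube]; positivity

lemma X_pow_numFixed (c : Fin n → Option Bool) :
    (X : ℤ[X]) ^ numFixed c = ∏ k, if c k = none then 1 else X := by
  rw [Finset.prod_ite, Finset.prod_const_one, one_mul, Finset.prod_const, numFixed]

/-- The monomial of a face is a product over coordinates, so the sum over independent choices
factors. -/
lemma sum_piFinset_X_pow_numFixed (A : Fin n → Finset (Option Bool)) :
    ∑ c ∈ Fintype.piFinset A, (X : ℤ[X]) ^ numFixed c =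
      ∏ k, ∑ o ∈ A k, if o = none then 1 else X := by
  rw [Finset.prod_univ_sum]
  exact Finset.sum_congr rfl fun c _ => X_pow_numFixed c

lemma sum_X_pow_numFixed :
    ∑ c : Fin n → Option Bool, (X : ℤ[X]) ^ numFixed c = (1 + 2 * X) ^ n := by
  have h := sum_piFinset_X_pow_numFixed (n := n) fun _ => Finset.univ
  rw [Fintype.piFinset_univ] at h
  rw [h]
  simp [two_mul]

end Subcube

/-! ### Cubical families -/

section Family

variable {V : Type*} [DecidableEq V] {S : Finset (Finset V)} {n : ℕ}

lemma IsCube.card_eq {F : Finset V} (h : IsCube S n F) : F.card = 2 ^ n := by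
  obtain ⟨φ, hφ, rfl, -⟩ := h
  rw [Finset.card_image_of_injective _ hφ]
  simp

/-- The dimension of a cube with vertex set `G`. -/
def cubeDim (G : Finset V) : ℕ := Nat.log 2 G.card

lemma IsCube.cubeDim_eq {F : Finset V} (h : IsCube S n F) : cubeDim F = n := by
  rw [cubeDim, h.card_eq, Nat.log_pow (by norm_num)]

lemma IsCube.nonempty {F : Finset V} (h : IsCube S n F) : F.Nonempty := by
  rw [← Finset.card_pos, h.card_eq]; positivity

lemma card_image_subcube {φ : (Fin n → Bool) → V} (hφ : Function.Injective φ)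
    (c : Fin n → Option Bool) : ((subcube c).image φ).card = 2 ^ (n - numFixed c) := by
  rw [Finset.card_image_of_injective _ hφ, card_subcube]

lemma cubeDim_image_subcube {φ : (Fin n → Bool) → V} (hφ : Function.Injective φ)
    (c : Fin n → Option Bool) : cubeDim ((subcube c).image φ) = n - numFixed c := by
  rw [cubeDim, card_image_subcube hφ, Nat.log_pow (by norm_num)]

/-- The rank of a face. -/
def faceRank (G : Finset V) : ℕ := if G = ∅ then 0 else cubeDim G + 1

/-- The polynomial `g` of the boundary of a face. -/
noncomputable def faceG (G : Finset V) : ℤ[X] := if G = ∅ then 1 else gCube (cubeDim G)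

/-- The contribution of a face to the polynomial `f` of a complex of rank `N`. -/
noncomputable def faceWeight (N : ℕ) (G : Finset V) : ℤ[X] := faceG G * (X - 1) ^ (N - faceRank G)

lemma IsCube.faceRank_eq {F : Finset V} (h : IsCube S n F) : faceRank F = n + 1 := by
  rw [faceRank, if_neg h.nonempty.ne_empty, h.cubeDim_eq]

lemma IsCube.faceG_eq {F : Finset V} (h : IsCube S n F) : faceG F = gCube n := by
  rw [faceG, if_neg h.nonempty.ne_empty, h.cubeDim_eq]

lemma faceWeight_empty (N : ℕ) : faceWeight N (∅ : Finset V) = (X - 1) ^ N := by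
  simp [faceWeight, faceG, faceRank]

lemma faceWeight_image_subcube {φ : (Fin n → Bool) → V} (hφ : Function.Injective φ)
    (c : Fin n → Option Bool) :
    faceWeight (n + 1) ((subcube c).image φ) = faceSum n (X ^ numFixed c) := by
  have hne : (subcube c).image φ ≠ ∅ := ((subcube_nonempty c).image φ).ne_empty
  rw [faceWeight, faceG, faceRank, if_neg hne, if_neg hne, cubeDim_image_subcube hφ,
    faceSum_X_pow (numFixed_le c)]
  congr 2
  have := numFixed_le c
  omega

lemma filter_subset_eq {F : Finset V} {φ : (Fin n → Bool) → V} (h0 : ∅ ∈ S)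
    (hF : F = Finset.univ.image φ)
    (hS : ∀ G ⊆ F, G ∈ S ↔ G = ∅ ∨ ∃ c : Fin n → Option Bool, G = (subcube c).image φ) :
    S.filter (· ⊆ F) = insert ∅ (Finset.univ.image fun c => (subcube c).image φ) := by
  ext G
  simp only [Finset.mem_filter, Finset.mem_insert, Finset.mem_image, Finset.mem_univ, true_and]
  constructor
  · rintro ⟨h1, h2⟩
    rcases (hS G h2).1 h1 with h | ⟨c, h⟩
    · exact Or.inl h
    · exact Or.inr ⟨c, h.symm⟩
  · rintro (rfl | ⟨c, rfl⟩)
    · exact ⟨h0, Finset.empty_subset _⟩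
    · have : (subcube c).image φ ⊆ F := by
        rw [hF]; exact Finset.image_subset_image (Finset.subset_univ _)
      exact ⟨(hS _ this).2 (Or.inr ⟨c, rfl⟩), this⟩

lemma image_subcube_injective {φ : (Fin n → Bool) → V} (hφ : Function.Injective φ) :
    Function.Injective fun c : Fin n → Option Bool => (subcube c).image φ :=
  fun _ _ h => subcube_injective (Finset.image_injective hφ h)

lemma IsCube.sum_faceWeight {F : Finset V} (h0 : ∅ ∈ S) (h : IsCube S n F) :
    ∑ G ∈ S.filter (· ⊆ F), faceWeight (n + 1) G = shellingPoly n 0 0 := by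
  obtain ⟨φ, hφ, hF, hS⟩ := h
  rw [filter_subset_eq h0 hF hS, Finset.sum_insert, Finset.sum_image, faceWeight_empty,
    ← faceSum_cube, ← sum_X_pow_numFixed, faceSum_sum]
  · congr 1
    exact Finset.sum_congr rfl fun c _ => faceWeight_image_subcube hφ c
  · exact (image_subcube_injective hφ).injOn
  · simp only [Finset.mem_image, Finset.mem_univ, true_and, not_exists]
    exact fun c => ((subcube_nonempty c).image φ).ne_empty

/-- A family of vertex sets whose nonempty members are cubes in it. -/
structure IsCubicalFamily (S : Finset (Finset V)) : Prop where
  empty_mem : ∅ ∈ S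
  isCube : ∀ G ∈ S, G.Nonempty → ∃ n, IsCube S n G

namespace IsCubicalFamily

variable (hS : IsCubicalFamily S)
include hS

/-- Dimension is determined by the number of vertices, so strict inclusion raises it whatever the
labellings. -/
lemma faceRank_lt {G H : Finset V} (hG : G ∈ S) (hH : H ∈ S) (h : G ⊂ H) :
    faceRank G < faceRank H := by
  have hHn : H.Nonempty := Finset.nonempty_iff_ne_empty.2
    fun e => Finset.not_ssubset_empty G (e ▸ h)
  obtain ⟨m, hm⟩ := hS.isCube H hH hHn
  rw [hm.faceRank_eq]
  rcases G.eq_empty_or_nonempty with rfl | hGn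
  · simp [faceRank]
  · obtain ⟨l, hl⟩ := hS.isCube G hG hGn
    rw [hl.faceRank_eq]
    have h1 := Finset.card_lt_card h
    rw [hl.card_eq, hm.card_eq] at h1
    have := (Nat.pow_lt_pow_iff_right (by norm_num : 1 < 2)).1 h1
    omega

lemma exists_faceRank_eq {G : Finset V} (hG : G ∈ S) {m : ℕ} (h : faceRank G = m + 1) :
    ∃ H ∈ S, H ⊂ G ∧ faceRank H = m := by
  have hne : G.Nonempty := by
    rw [Finset.nonempty_iff_ne_empty]; rintro rfl; simp [faceRank] at h
  obtain ⟨n, hn⟩ := hS.isCube G hG hne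
  have hnm : n = m := by rw [hn.faceRank_eq] at h; omega
  subst hnm
  cases n with
  | zero => exact ⟨∅, hS.empty_mem, hne.empty_ssubset, by simp [faceRank]⟩
  | succ n =>
    obtain ⟨φ, hφ, hF, hS'⟩ := hn
    set c : Fin (n + 1) → Option Bool := fun k => if k = 0 then some true else none with hc
    have hfix : numFixed c = 1 := by simp [numFixed, hc, Finset.filter_eq']
    have hsub : (subcube c).image φ ⊆ G := by
      rw [hF]; exact Finset.image_subset_image (Finset.subset_univ _)
    have hcard := card_image_subcube hφ c
    rw [hfix] at hcard
    refine ⟨(subcube c).image φ, (hS' _ hsub).2 (Or.inr ⟨c, rfl⟩), ?_, ?_⟩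
    · refine hsub.ssubset_of_ne fun e => ?_
      have h2 : G.card = 2 ^ (n + 1) := by
        rw [hF, Finset.card_image_of_injective _ hφ]; simp
      rw [e, h2] at hcard
      have := Nat.pow_right_injective (le_refl 2) hcard
      omega
    · rw [faceRank, if_neg ((subcube_nonempty c).image φ).ne_empty, cubeDim_image_subcube hφ, hfix]
      omega

/-- Rank is strictly monotone, and every nonempty face contains one of rank exactly one less;
together these determine the height. -/
lemma height_eq (m : ℕ) : ∀ t : {G // G ∈ S}, faceRank t.1 = m → Order.height t = m := by
  induction m using Nat.strong_induction_on with
  | _ m ih =>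
    intro t ht
    apply le_antisymm
    · rw [Order.height_le_coe_iff]
      intro s hs
      have h1 := hS.faceRank_lt s.2 t.2 hs
      rw [ih _ (ht ▸ h1) s rfl]
      exact_mod_cast ht ▸ h1
    · cases m with
      | zero => simp
      | succ m =>
        obtain ⟨H, hH, hlt, hr⟩ := hS.exists_faceRank_eq t.2 ht
        have h1 := ih m (Nat.lt_succ_self m) ⟨H, hH⟩ hr
        have hlt' : (⟨H, hH⟩ : {G // G ∈ S}) < t := hlt
        have h2 := Order.height_strictMono hlt' (by rw [h1]; exact ENat.natCast_lt_top m)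
        rw [h1] at h2
        exact Order.add_one_le_of_lt h2

lemma rank_eq (t : {G // G ∈ S}) : Toric.rank t = faceRank t.1 := by
  rw [Toric.rank, hS.height_eq _ t rfl, ENat.toNat_natCast]

/-- Induction over faces: the values below `t` are known, so Stanley's sum for `t` is the full face
sum of a cube without its top term, and the truncation is the one computed by `gTrunc_eq_gCube`. -/
theorem gBelow_eq (t : {G // G ∈ S}) : Toric.gBelow t = faceG t.1 := by
  induction t using WellFoundedLT.induction with
  | _ t ih =>
    rw [Toric.gBelow]
    by_cases he : t.1 = ∅
    · rw [if_pos, faceG, if_pos he]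
      intro s hs
      have : s.1 ⊆ t.1 := hs
      rw [he, Finset.subset_empty] at this
      exact (show t.1 ⊆ s.1 by rw [he]; exact Finset.empty_subset _)
    · have hne := Finset.nonempty_iff_ne_empty.2 he
      rw [if_neg]
      swap
      · intro hmin
        have := @hmin ⟨∅, hS.empty_mem⟩ (Finset.empty_subset t.1)
        exact he (Finset.subset_empty.1 this)
      obtain ⟨n, hn⟩ := hS.isCube t.1 t.2 hne
      rw [hS.rank_eq, hn.faceRank_eq, hn.faceG_eq, Nat.add_sub_cancel]
      apply gTrunc_eq_gCube
      rw [← hn.sum_faceWeight hS.empty_mem]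
      have h1 : S.filter (· ⊆ t.1) = insert t.1 (S.filter (· ⊂ t.1)) := by
        ext G
        simp only [Finset.mem_filter, Finset.mem_insert, Finset.ssubset_iff_subset_ne]
        constructor
        · rintro ⟨a, b⟩
          by_cases e : G = t.1
          · exact Or.inl e
          · exact Or.inr ⟨a, b, e⟩
        · rintro (rfl | ⟨a, b, -⟩)
          · exact ⟨t.2, subset_rfl⟩
          · exact ⟨a, b⟩
      rw [h1, Finset.sum_insert (by simp), add_comm, faceWeight, hn.faceG_eq, hn.faceRank_eq,
        Nat.sub_self, pow_zero, mul_one, Finset.mul_sum]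
      congr 1
      refine Finset.sum_bij (fun s _ => s.1.1) ?_ ?_ ?_ ?_
      · intro s _
        exact Finset.mem_filter.2 ⟨s.1.2, s.2⟩
      · intro a _ b _ h
        exact Subtype.ext (Subtype.ext h)
      · intro G hG
        rw [Finset.mem_filter] at hG
        exact ⟨⟨⟨G, hG.1⟩, hG.2⟩, @Finset.mem_univ _ (_) _, rfl⟩
      · intro s _
        -- Strictness makes `n - ρ(s)` a genuine difference; the weight at rank `n + 1` then has
        -- exactly one more factor `X - 1`.
        have hlt := hS.faceRank_lt s.1.2 t.2 s.2
        rw [hn.faceRank_eq] at hlt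
        rw [ih s.1 s.2, hS.rank_eq, faceWeight,
          show n + 1 - faceRank s.1.1 = n - faceRank s.1.1 + 1 by omega]
        ring

lemma maxChain_eq {N : ℕ} (hle : ∀ G ∈ S, faceRank G ≤ N) (hex : ∃ G ∈ S, faceRank G = N) :
    Toric.maxChain {G // G ∈ S} = N := by
  apply le_antisymm
  · refine Finset.sup_le fun t _ => ?_
    rw [hS.rank_eq]; exact hle _ t.2
  · obtain ⟨G, hG, rfl⟩ := hex
    rw [← hS.rank_eq ⟨G, hG⟩]
    exact Finset.le_sup (f := Toric.rank) (Finset.mem_univ _)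

lemma toricF_eq {N : ℕ} (hN : Toric.maxChain {G // G ∈ S} = N) :
    Toric.toricF {G // G ∈ S} = ∑ G ∈ S, faceWeight N G := by
  rw [Toric.toricF, if_neg, hN, ← Finset.sum_coe_sort S]
  · refine Finset.sum_congr rfl fun t _ => ?_
    rw [hS.gBelow_eq, hS.rank_eq, faceWeight]
  · rw [not_isEmpty_iff]; exact ⟨⟨∅, hS.empty_mem⟩⟩

end IsCubicalFamily

end Family

/-! ### Ridges of the cube -/

section Ridges

variable {n : ℕ}

/-- The facet of the `n`-cube in which coordinate `p.1` is fixed to the value `p.2`. -/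
def ridge (p : Fin n × Bool) : Fin n → Option Bool := fun l => if l = p.1 then some p.2 else none

lemma subcube_subset_ridge {c : Fin n → Option Bool} {p : Fin n × Bool} :
    subcube c ⊆ subcube (ridge p) ↔ c p.1 = some p.2 := by
  rw [subcube_subset_subcube]
  constructor
  · intro h
    rcases h p.1 with h | h <;> simp [ridge] at h
    exact h.symm
  · intro h k
    by_cases hk : k = p.1
    · right; simp [ridge, hk, h]
    · left; simp [ridge, hk]

lemma ridge_injective : Function.Injective (ridge : Fin n × Bool → _) := by
  intro p q h
  have h1 := congrFun h p.1
  by_cases hk : p.1 = q.1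
  · simp [ridge, hk] at h1
    exact Prod.ext hk h1
  · simp [ridge, hk] at h1

lemma numFixed_ridge (p : Fin n × Bool) : numFixed (ridge p) = 1 := by
  simp [numFixed, ridge, Finset.filter_eq']

lemma exists_ridge_eq {c : Fin n → Option Bool} (h : numFixed c = 1) : ∃ p, c = ridge p := by
  obtain ⟨k, hk⟩ := Finset.card_eq_one.1 h
  have hiff : ∀ l, c l ≠ none ↔ l = k := fun l => by
    have := Finset.ext_iff.1 hk l
    simpa using this
  obtain ⟨b, hb⟩ := Option.ne_none_iff_exists'.1 ((hiff k).2 rfl)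
  refine ⟨(k, b), funext fun l => ?_⟩
  by_cases hl : l = k
  · subst hl; simp [ridge, hb]
  · have : c l = none := by
      by_contra h'
      exact hl ((hiff l).1 h')
    simp [ridge, hl, this]

lemma disjoint_ridge {p q : Fin n × Bool} :
    Disjoint (subcube (ridge p)) (subcube (ridge q)) ↔ q = (p.1, !p.2) := by
  have hmem : ∀ (p : Fin n × Bool) v, v ∈ subcube (ridge p) ↔ v p.1 = p.2 := by
    intro p v
    rw [mem_subcube]
    constructor
    · intro h
      rcases h p.1 with h | h <;> simp [ridge] at h
      exact h.symm
    · intro h k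
      by_cases hk : k = p.1
      · right; simp [ridge, hk, h]
      · left; simp [ridge, hk]
  constructor
  · intro h
    by_contra hne
    have hv : ∃ v : Fin n → Bool, v p.1 = p.2 ∧ v q.1 = q.2 := by
      by_cases hk : q.1 = p.1
      · refine ⟨fun _ => p.2, rfl, ?_⟩
        by_contra h2
        apply hne
        refine Prod.ext hk ?_
        revert h2
        cases p.2 <;> cases q.2 <;> simp
      · exact ⟨fun l => if l = p.1 then p.2 else q.2, by simp, by simp [hk]⟩
    obtain ⟨v, h1, h2⟩ := hv
    exact Finset.disjoint_left.1 h ((hmem _ _).2 h1) ((hmem _ _).2 h2)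
  · rintro rfl
    rw [Finset.disjoint_left]
    intro v h1 h2
    rw [hmem] at h1 h2
    simp [h1] at h2

open Classical in
/-- Generating function of the codimensions of the faces of the cube that lie in none of the
ridges in `B`, where `B` consists of `i` unpaired ridges and of `j` antipodal pairs. -/
lemma exists_sum_avoiding_ridges (B : Finset (Fin n × Bool)) {i j : ℕ}
    (hi : (B.filter fun p => (p.1, !p.2) ∉ B).card = i)
    (hj : (B.filter fun p => (p.1, !p.2) ∈ B).card = 2 * j) :
    ∃ u, i + j + u = n ∧
      ∑ c ∈ Fintype.piFinset fun k => Finset.univ.filter fun o => ∀ b, o = some b → (k, b) ∉ B,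
        (X : ℤ[X]) ^ numFixed c = (1 + X) ^ i * (1 + 2 * X) ^ u := by
  have hcard : ∀ (P : Fin n × Bool → Prop) [DecidablePred P], (Finset.univ.filter P).card =
      ∑ k, ((if P (k, true) then 1 else 0) + (if P (k, false) then 1 else 0)) := by
    intro P _
    rw [Finset.card_filter, Fintype.sum_prod_type]
    exact Finset.sum_congr rfl fun k _ => Fintype.sum_bool _
  have hB : ∀ (P : Fin n × Bool → Prop) [DecidablePred P],
      B.filter P = Finset.univ.filter fun p => p ∈ B ∧ P p := by
    intro P _; ext; simp
  rw [hB, hcard] at hi hj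
  refine ⟨∑ k, if (k, true) ∉ B ∧ (k, false) ∉ B then 1 else 0, ?_, ?_⟩
  · have h : 2 * (i + j + ∑ k, if (k, true) ∉ B ∧ (k, false) ∉ B then 1 else 0) = 2 * n := by
      have h2 : ∑ _k : Fin n, 2 = 2 * n := by simp [mul_comm]
      rw [mul_add, mul_add, ← hj, ← hi, ← h2, Finset.mul_sum, Finset.mul_sum,
        ← Finset.sum_add_distrib, ← Finset.sum_add_distrib]
      refine Finset.sum_congr rfl fun k _ => ?_
      by_cases h1 : (k, true) ∈ B <;> by_cases h0 : (k, false) ∈ B <;> simp [h1, h0]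
    omega
  · rw [sum_piFinset_X_pow_numFixed, ← hi, ← Finset.prod_pow_eq_pow_sum,
      ← Finset.prod_pow_eq_pow_sum, ← Finset.prod_mul_distrib]
    refine Finset.prod_congr rfl fun k _ => ?_
    rw [Finset.sum_filter, Fintype.sum_option]
    by_cases h1 : (k, true) ∈ B <;> by_cases h0 : (k, false) ∈ B <;> simp [h1, h0, two_mul]

end Ridges

/-! ### Shellings -/

namespace CubicalComplex

variable {V : Type*} [DecidableEq V] {K : CubicalComplex V} {n r : ℕ} {F : Fin r → Finset V}

lemma mem_initialFaces {m : ℕ} {G : Finset V} :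
    G ∈ K.initialFaces F m ↔ G ∈ K.faces ∧ ∃ s : Fin r, s.val < m ∧ G ⊆ F s := by
  simp [initialFaces]

lemma isCubicalFamily_faces : IsCubicalFamily K.faces := ⟨K.empty_mem, K.isCube⟩

/-- Initial subcomplexes are closed under passing to faces, so the labellings in `K` still work; `t`
witnesses that the empty face is present. -/
lemma isCubicalFamily_initialFaces {m : ℕ} (t : Fin r) (ht : t.val < m) :
    IsCubicalFamily (K.initialFaces F m) := by
  refine ⟨mem_initialFaces.2 ⟨K.empty_mem, t, ht, Finset.empty_subset _⟩, fun G hG hne => ?_⟩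
  obtain ⟨hGK, s, hs, hGs⟩ := mem_initialFaces.1 hG
  obtain ⟨l, φ, hφ, hF, hS⟩ := K.isCube G hGK hne
  refine ⟨l, φ, hφ, hF, fun H hH => ?_⟩
  rw [← hS H hH, mem_initialFaces]
  exact ⟨fun h => h.1, fun h => ⟨h, s, hs, hH.trans hGs⟩⟩

lemma IsShelling.mem_faces {d : ℕ} (hF : K.IsShelling d F) (t : Fin r) : F t ∈ K.faces :=
  ((hF.facets (F t)).1 ⟨t, rfl⟩).1

lemma IsShelling.maxChain_eq (hF : K.IsShelling (n + 1) F) {m : ℕ} (t : Fin r) (ht : t.val < m) :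
    Toric.maxChain (K.InitialPoset F m) = n + 1 := by
  refine (isCubicalFamily_initialFaces t ht).maxChain_eq (fun G hG => ?_) ⟨F t, ?_, ?_⟩
  · obtain ⟨hGK, s, -, hGs⟩ := mem_initialFaces.1 hG
    have hs : faceRank (F s) = n + 1 := (hF.dim s).faceRank_eq
    rw [← hs]
    rcases hGs.eq_or_ssubset with h | h
    · rw [h]
    · exact (isCubicalFamily_faces.faceRank_lt hGK (hF.mem_faces s) h).le
  · exact mem_initialFaces.2 ⟨hF.mem_faces t, t, ht, subset_rfl⟩
  · exact (hF.dim t).faceRank_eq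

lemma IsShelling.toricF_eq (hF : K.IsShelling (n + 1) F) {m : ℕ} (t : Fin r) (ht : t.val < m) :
    Toric.toricF (K.InitialPoset F m) = ∑ G ∈ K.initialFaces F m, faceWeight (n + 1) G :=
  (isCubicalFamily_initialFaces t ht).toricF_eq (hF.maxChain_eq t ht)

/-- All nonempty initial posets have the same maximal chain length, so both terms are reflected at
the same degree. -/
lemma IsShelling.hChange_eq (hF : K.IsShelling (n + 1) F) (t : Fin r) :
    K.hChange F t = (K.fChange F t).reflect (n + 1) := by
  rw [hChange, fChange, reflect_sub, Toric.toricH, hF.maxChain_eq t (Nat.lt_succ_self _)]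
  congr 1
  split_ifs with h
  · simp
  · rw [Toric.toricH, hF.maxChain_eq ⟨0, t.pos⟩ (Nat.pos_of_ne_zero h)]

lemma IsShelling.fChange_zero (hF : K.IsShelling (n + 1) F) (t : Fin r) (ht : t.val = 0) :
    K.fChange F t = shellingPoly n 0 0 := by
  rw [fChange, if_pos ht, sub_zero, hF.toricF_eq t (Nat.lt_succ_self _)]
  have hd : IsCube K.faces n (F t) := hF.dim t
  rw [← hd.sum_faceWeight K.empty_mem]
  refine Finset.sum_congr ?_ fun _ _ => rfl
  ext G
  rw [mem_initialFaces, Finset.mem_filter]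
  refine and_congr_right fun _ => ⟨?_, fun h => ⟨t, Nat.lt_succ_self _, h⟩⟩
  rintro ⟨s, hs, h⟩
  rwa [show t = s from Fin.ext (by omega)]

section Labelled

variable {t : Fin r} {φ : (Fin n → Bool) → V}

open Classical in
/-- The ridges of a labelled cube that are shared with earlier facets. -/
def sharedLabels (K : CubicalComplex V) (F : Fin r → Finset V) (t : Fin r)
    (φ : (Fin n → Bool) → V) : Finset (Fin n × Bool) :=
  Finset.univ.filter fun p => (subcube (ridge p)).image φ ∈ K.initialFaces F t.val

lemma mem_sharedLabels {p : Fin n × Bool} :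
    p ∈ sharedLabels K F t φ ↔ (subcube (ridge p)).image φ ∈ K.initialFaces F t.val := by
  simp [sharedLabels]

variable (hφ : Function.Injective φ) (hFt : F t = Finset.univ.image φ)
  (hS : ∀ G ⊆ F t, G ∈ K.faces ↔
    G = ∅ ∨ ∃ c : Fin n → Option Bool, G = (subcube c).image φ)
include hφ

lemma image_ridge_injective :
    Function.Injective fun p : Fin n × Bool => (subcube (ridge p)).image φ :=
  (image_subcube_injective hφ).comp ridge_injective

include hFt hS

/-- The vertex count forces a face of dimension `n - 1` in `F t` to have exactly one fixed
coordinate. -/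
lemma sharedRidges_eq : K.sharedRidges (n + 1) F t =
    (sharedLabels K F t φ).image fun p => (subcube (ridge p)).image φ := by
  ext R
  simp only [sharedRidges, Finset.mem_filter, Finset.mem_image, mem_sharedLabels]
  constructor
  · rintro ⟨hR, hRF, m, hm, hcube⟩
    rcases (hS R hRF).1 (mem_initialFaces.1 hR).1 with h | ⟨c, hc⟩
    · exact absurd h hcube.nonempty.ne_empty
    · have h1 := hcube.card_eq
      rw [hc, card_image_subcube hφ] at h1
      have h2 := Nat.pow_right_injective (le_refl 2) h1
      obtain ⟨p, rfl⟩ := exists_ridge_eq (c := c) (by have := numFixed_le c; omega)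
      exact ⟨p, hc ▸ hR, hc.symm⟩
  · rintro ⟨p, hp, rfl⟩
    refine ⟨hp, ?_, ?_⟩
    · rw [hFt]; exact Finset.image_subset_image (Finset.subset_univ _)
    · obtain ⟨m, hm⟩ := K.isCube _ (mem_initialFaces.1 hp).1 ((subcube_nonempty _).image φ)
      refine ⟨m, ?_, hm⟩
      have h1 := hm.card_eq
      rw [card_image_subcube hφ, numFixed_ridge] at h1
      have h2 := Nat.pow_right_injective (le_refl 2) h1
      have := p.1.pos
      omega

lemma pairedRidges_eq : K.pairedRidges (n + 1) F t =
    ((sharedLabels K F t φ).filter fun p => (p.1, !p.2) ∈ sharedLabels K F t φ).image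
      fun p => (subcube (ridge p)).image φ := by
  ext R
  rw [pairedRidges, sharedRidges_eq hφ hFt hS]
  simp only [Finset.mem_filter, Finset.mem_image]
  constructor
  · rintro ⟨⟨p, hp, rfl⟩, G', ⟨q, hq, rfl⟩, hd⟩
    rw [Finset.disjoint_image hφ, disjoint_ridge] at hd
    exact ⟨p, ⟨hp, hd ▸ hq⟩, rfl⟩
  · rintro ⟨p, ⟨hp, hq⟩, rfl⟩
    refine ⟨⟨p, hp, rfl⟩, _, ⟨_, hq, rfl⟩, ?_⟩
    rw [Finset.disjoint_image hφ, disjoint_ridge]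

open Classical in
-- A face is old exactly when it lies in a shared ridge, which is where the covering condition of
-- the type enters. Lying in a ridge means having that coordinate fixed to that value. The empty
-- face is old because `t` is not first.
lemma new_faces_eq (ht : t.val ≠ 0) {i j : ℕ} (htype : K.HasType (n + 1) F t i j) :
    K.initialFaces F (t.val + 1) \ K.initialFaces F t.val =
      (Fintype.piFinset fun k => Finset.univ.filter fun o =>
        ∀ b, o = some b → (k, b) ∉ sharedLabels K F t φ).image fun c => (subcube c).image φ := by
  ext G
  simp only [Finset.mem_sdiff, Finset.mem_image, Fintype.mem_piFinset, Finset.mem_filter,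
    Finset.mem_univ, true_and]
  constructor
  · rintro ⟨h1, h2⟩
    obtain ⟨hGK, s, hs, hGs⟩ := mem_initialFaces.1 h1
    have hst : s = t := by
      by_contra hne
      have : s.val ≠ t.val := fun h => hne (Fin.ext h)
      exact h2 (mem_initialFaces.2 ⟨hGK, s, by omega, hGs⟩)
    subst hst
    rcases (hS G hGs).1 hGK with rfl | ⟨c, rfl⟩
    · exact absurd (mem_initialFaces.2 ⟨hGK, ⟨0, s.pos⟩, Nat.pos_of_ne_zero ht,
        Finset.empty_subset _⟩) h2
    · refine ⟨c, fun k b hc hk => h2 ?_, rfl⟩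
      obtain ⟨-, s', hs', hsub⟩ := mem_initialFaces.1 (mem_sharedLabels.1 hk)
      refine mem_initialFaces.2 ⟨hGK, s', hs', (Finset.image_subset_image ?_).trans hsub⟩
      exact subcube_subset_ridge.2 hc
  · rintro ⟨c, hc, rfl⟩
    have hsub : (subcube c).image φ ⊆ F t := by
      rw [hFt]; exact Finset.image_subset_image (Finset.subset_univ _)
    refine ⟨mem_initialFaces.2 ⟨(hS _ hsub).2 (Or.inr ⟨c, rfl⟩), t, Nat.lt_succ_self _, hsub⟩,
      fun h => ?_⟩
    obtain ⟨R, hR, hGR⟩ := htype.1 _ h hsub ((subcube_nonempty c).image φ)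
    rw [sharedRidges_eq hφ hFt hS, Finset.mem_image] at hR
    obtain ⟨p, hp, rfl⟩ := hR
    rw [Finset.image_subset_image_iff hφ, subcube_subset_ridge] at hGR
    exact hc p.1 p.2 hGR hp

end Labelled

lemma IsShelling.exists_fChange_eq (hF : K.IsShelling (n + 1) F) {t : Fin r} (ht : t.val ≠ 0)
    {i j : ℕ} (htype : K.HasType (n + 1) F t i j) :
    ∃ u, i + j + u = n ∧ K.fChange F t = faceSum n ((1 + X) ^ i * (1 + 2 * X) ^ u) := by
  classical
  obtain ⟨φ, hφ, hFt, hS⟩ := hF.dim t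
  -- The dimension arrives as `n + 1 - 1`.
  change (Fin n → Bool) → V at φ
  have hi := htype.2.1
  have hj := htype.2.2
  rw [sharedRidges_eq hφ hFt hS, pairedRidges_eq hφ hFt hS,
    ← Finset.image_sdiff _ _ (image_ridge_injective hφ),
    Finset.card_image_of_injective _ (image_ridge_injective hφ),
    ← Finset.filter_not] at hi
  rw [pairedRidges_eq hφ hFt hS,
    Finset.card_image_of_injective _ (image_ridge_injective hφ)] at hj
  obtain ⟨u, hu, hsum⟩ := exists_sum_avoiding_ridges (sharedLabels K F t φ)
    (by convert hi) (by convert hj)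
  refine ⟨u, hu, ?_⟩
  have hsub : K.initialFaces F t.val ⊆ K.initialFaces F (t.val + 1) := by
    intro G hG
    obtain ⟨h1, s, hs, h2⟩ := mem_initialFaces.1 hG
    exact mem_initialFaces.2 ⟨h1, s, by omega, h2⟩
  rw [fChange, if_neg ht, hF.toricF_eq t (Nat.lt_succ_self _),
    hF.toricF_eq ⟨0, t.pos⟩ (Nat.pos_of_ne_zero ht), ← Finset.sum_sdiff_eq_sub hsub,
    new_faces_eq hφ hFt hS ht htype, Finset.sum_image (image_subcube_injective hφ).injOn,
    ← hsum, faceSum_sum]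
  exact Finset.sum_congr rfl fun c _ => faceWeight_image_subcube hφ c

lemma HasType.eq_zero {d i j : ℕ} {t : Fin r} (h : K.HasType d F t i j) (ht : t.val = 0) :
    i = 0 ∧ j = 0 := by
  have h0 : K.sharedRidges d F t = ∅ := by
    simp [sharedRidges, initialFaces, ht]
  have h1 : K.pairedRidges d F t = ∅ := by simp [pairedRidges, h0]
  obtain ⟨-, hi, hj⟩ := h
  rw [h0, h1] at hi
  rw [h1] at hj
  simp at hi hj
  omega

/-- The ridge counts determine the type, so the restriction on the type supplied by the shelling
applies to `(i, j)`. -/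
lemma IsShelling.ne_zero_of_hasType {d i j : ℕ} (hF : K.IsShelling d F) {t : Fin r}
    (ht : t.val ≠ 0) (htype : K.HasType d F t i j) (hj : j ≠ d - 1) : i ≠ 0 := by
  obtain ⟨i', j', h, h0⟩ := hF.step t ht
  have hi : i' = i := h.2.1.symm.trans htype.2.1
  have hj' : 2 * j' = 2 * j := h.2.2.symm.trans htype.2.2
  rintro rfl
  exact hj (by rw [← h0 hi]; omega)

end CubicalComplex

theorem theorem2p1 {V : Type*} [DecidableEq V] (K : CubicalComplex V) (d : ℕ) (hd : 1 ≤ d)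
    {r : ℕ} (F : Fin r → Finset V) (hF : K.IsShelling d F)
    (t : Fin r) (i j : ℕ) (htype : K.HasType d F t i j) :
    ((t.val = 0 ∨ j ≠ d - 1) →
      K.fChange F t =
        ∑ k ∈ Finset.range d, (catalan (d - 1 - k) : ℤ[X]) * (1 - X) ^ k * X ^ (d - k) *
          (shellingCoeff d i j k : ℤ[X]) ∧
      K.hChange F t =
        ∑ k ∈ Finset.range d, (catalan (d - 1 - k) : ℤ[X]) * (X - 1) ^ k *
          (shellingCoeff d i j k : ℤ[X])) ∧
    ((t.val ≠ 0 ∧ i = 0 ∧ j = d - 1) →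
      K.fChange F t =
        ∑ k ∈ Finset.range d, (catalan (d - 1 - k) : ℤ[X]) *
          ((d - 1 - k).choose k : ℤ[X]) * (X - 1) ^ k ∧
      K.hChange F t =
        ∑ k ∈ Finset.range d, (catalan (d - 1 - k) : ℤ[X]) *
          ((d - 1 - k).choose k : ℤ[X]) * X ^ (d - k) * (1 - X) ^ k) := by
  obtain ⟨n, rfl⟩ : ∃ n, d = n + 1 := ⟨d - 1, by omega⟩
  rw [hF.hChange_eq, Nat.add_sub_cancel, ← reflect_shellingPoly, ← reflect_gCube]
  refine ⟨fun h => ?_, ?_⟩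
  · suffices hf : K.fChange F t = shellingPoly n i j from ⟨hf, by rw [hf]⟩
    by_cases ht : t.val = 0
    · obtain ⟨rfl, rfl⟩ := htype.eq_zero ht
      exact hF.fChange_zero t ht
    · have hi := hF.ne_zero_of_hasType ht htype (h.resolve_left ht)
      obtain ⟨i, rfl⟩ := Nat.exists_eq_succ_of_ne_zero hi
      obtain ⟨u, hu, hf⟩ := hF.exists_fChange_eq ht htype
      rw [hf, ← hu]
      exact faceSum_shelling i j u
  · rintro ⟨ht, rfl, rfl⟩
    obtain ⟨u, hu, hf⟩ := hF.exists_fChange_eq ht htype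
    -- No direction is left over, so the generating function is `1`.
    obtain rfl : u = 0 := by omega
    rw [pow_zero, pow_zero, mul_one, faceSum_one] at hf
    exact ⟨hf, by rw [hf]⟩
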